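/- Let $(R,\mathfrak m)$ be a Noetherian local ring with infinite residue field, $\mathfrak q$ an $\mathfrak m$-primary ideal and $M$ a finitely generated $R$-module of dimension $d\ge 2$. Let $\mathbb M=\{M_n\}_{n\ge 0}$ be a good $\mathfrak q$-filtration of $M$, i.e. $M=M_0\supseteq M_1\supseteq\cdots$ are submodules with $\mathfrak qM_n\subseteq M_{n+1}$ for all $n\ge 0$ and $\mathfrak qM_n=M_{n+1}$ for all sufficiently large $n$. An element $a\in\mathfrak q$ is called $\mathbb M$-superficial for $\mathfrak q$ if there is $c\ge 0$ with $(M_{n+1}:_M a)\cap M_c=M_n$ for all $n\ge c$; a sequence $a_1,\dots,a_r$ is called $\mathbb M$-superficial for $\mathfrak q$ if each $a_i$ is superficial for $\mathfrak q$ with respect to the filtration induced by $\mathbb M$ on $M/(a_1,\dots,a_{i-1})M$, and it is called maximal if $r=d$. Let $J=(a_1,\dots,a_d)$ be generated by a maximal $\mathbb M$-superficial sequence for $\mathfrak q$, and let $\mathbb N=\{J^nM\}_{n\ge 0}$ be the $J$-adic filtration of $M$. For $\mathbb F\in\{\mathbb M,\mathbb N\}$, with $F_n$ denoting its $n$-th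 term, write $\sum_{n\ge 0}\lambda(F_n/F_{n+1})t^n=h_{\mathbb F}(t)/(1-t)^d$ with $h_{\mathbb F}\in\mathbb Z[t]$, where $\lambda$ denotes length, and put $e_2(\mathbb F)=h_{\mathbb F}''(1)/2!$. If the associated graded module $gr_{\mathbb N}(M)=\bigoplus_{n\ge 0}J^nM/J^{n+1}M$ satisfies $\operatorname{depth} gr_{\mathbb N}(M)\ge d-1$ (depth with respect to the homogeneous maximal ideal of $\bigoplus_{n\ge 0}J^n/J^{n+1}$), then $$e_2(\mathbb M)-e_2(\mathbb N)\le\sum_{n\ge 1}n\,\lambda(M_{n+1}/JM_n),$$ where the sum on the right is finite. -/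

import Mathlib

open IsLocalRing

namespace HilbertFiltration

section Subquotients

variable {S : Type*} [CommRing S] {P : Type*} [AddCommGroup P] [Module S P]

/-- The subquotient `A / B` of the module `P`, for submodules `B ≤ A` of `P`
(in general, `A / (A ∩ B)`). -/
def Subquotient (A B : Submodule S P) : Type _ :=
  A ⧸ B.submoduleOf A

instance (A B : Submodule S P) : AddCommGroup (Subquotient A B) :=
  inferInstanceAs (AddCommGroup (A ⧸ B.submoduleOf A))

instance (A B : Submodule S P) : Module S (Subquotient A B) :=
  inferInstanceAs (Module S (A ⧸ B.submoduleOf A))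

theorem Subquotient.isTorsionBySet (A B : Submodule S P) (K : Ideal S)
    (h : ∀ s ∈ K, ∀ x ∈ A, s • x ∈ B) :
    Module.IsTorsionBySet S (Subquotient A B) (K : Set S) := by
  rintro x ⟨s, hs⟩
  obtain ⟨y, rfl⟩ := Submodule.Quotient.mk_surjective (B.submoduleOf A) x
  exact (Submodule.Quotient.mk_eq_zero (B.submoduleOf A) (x := s • y)).2 (h s hs y y.2)

end Subquotients

section Filtrations

variable {R : Type*} [CommRing R] {M : Type*} [AddCommGroup M] [Module R M] {I : Ideal R}

/-- A good `I`-filtration of `M`: a filtration `M = M_0 ⊇ M_1 ⊇ ⋯` by submodules with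
`I M_n ⊆ M_{n+1}` for all `n`, and `I M_n = M_{n+1}` for all large `n`. -/
structure IsGood (F : I.Filtration M) : Prop where
  zero_eq_top : F.N 0 = ⊤
  stable : F.Stable

/-- The filtration `{(M_n + N) / N}` induced on the quotient module `M / N`. -/
def quotientFiltration (F : I.Filtration M) (N : Submodule R M) : I.Filtration (M ⧸ N) where
  N n := (F.N n).map N.mkQ
  mono n := Submodule.map_mono (F.mono n)
  smul_le n := by
    rw [← Submodule.map_smul'']
    exact Submodule.map_mono (F.smul_le n)

/-- `a` is superficial for `I` with respect to the filtration `{M_n}`: `a ∈ I` and there is `c`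
with `(M_{n+1} :_M a) ∩ M_c = M_n` for all `n ≥ c`. -/
def IsSuperficial (F : I.Filtration M) (a : R) : Prop :=
  a ∈ I ∧ ∃ c : ℕ, ∀ n ≥ c,
    (F.N (n + 1)).comap (LinearMap.lsmul R M a) ⊓ F.N c = F.N n

/-- `a_0, …, a_{r-1}` is a superficial sequence: each `a_i` is superficial for `I` with respect to
the filtration induced on `M / (a_0, …, a_{i-1}) M`. -/
def IsSuperficialSequence (F : I.Filtration M) {r : ℕ} (a : Fin r → R) : Prop :=
  ∀ i : Fin r, IsSuperficial
    (quotientFiltration F (Ideal.span (a '' {j | j < i}) • (⊤ : Submodule R M))) (a i)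

/-- The `J`-adic filtration `{J ^ n M}` of `M`. -/
def adicFiltration (J : Ideal R) (M : Type*) [AddCommGroup M] [Module R M] : J.Filtration M :=
  J.stableFiltration ⊤

/-- The length `λ(P / Q)` of the subquotient `P / Q` of `M`. -/
noncomputable def subquotientLength (P Q : Submodule R M) : ℕ∞ :=
  Module.length R (Subquotient P Q)

end Filtrations

section HilbertCoefficients

variable {R : Type*} [CommRing R] {M : Type*} [AddCommGroup M] [Module R M] {I : Ideal R}

/-- The Hilbert function `n ↦ λ(M_n / M_{n+1})`. -/
noncomputable def hilbertFunction (F : I.Filtration M) (n : ℕ) : ℕ :=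
  (subquotientLength (F.N n) (F.N (n + 1))).toNat

/-- The Hilbert series `∑ λ(M_n / M_{n+1}) t ^ n`. -/
noncomputable def hilbertSeries (F : I.Filtration M) : PowerSeries ℤ :=
  PowerSeries.mk fun n => (hilbertFunction F n : ℤ)

/-- `h` is the `h`-polynomial of the filtration, where `d = dim M`: the Hilbert series
equals `h(t) / (1 - t) ^ d`. There is at most one such `h`. -/
def IsHPolynomial (F : I.Filtration M) (d : ℕ) (h : Polynomial ℤ) : Prop :=
  hilbertSeries F * (1 - PowerSeries.X) ^ d = (h : PowerSeries ℤ)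

open Classical in
/-- The `h`-polynomial of the filtration, where `d = dim M`. (It exists for every good filtration
with finite lengths, by the Hilbert-Serre theorem; the value `0` is used if there is none.) -/
noncomputable def hPolynomial (F : I.Filtration M) (d : ℕ) : Polynomial ℤ :=
  if H : ∃ h : Polynomial ℤ, IsHPolynomial F d h then H.choose else 0

/-- The Hilbert coefficient `e_i = h^{(i)}(1) / i!`, where `h` is the `h`-polynomial and
`d = dim M`; the Hasse derivative of order `i` is the `i`-th derivative divided by `i!`. -/
noncomputable def hilbertCoeff (F : I.Filtration M) (d i : ℕ) : ℤ :=
  (Polynomial.hasseDeriv i (hPolynomial F d)).eval 1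

end HilbertCoefficients

section AssociatedGraded

variable {R : Type*} [CommRing R] {M : Type*} [AddCommGroup M] [Module R M] {I : Ideal R}

/-- The ideal `I R[It]` of the Rees algebra `R[It]`. -/
noncomputable def reesIdeal (I : Ideal R) : Ideal (reesAlgebra I) :=
  I.map (algebraMap R (reesAlgebra I))

/-- The associated graded ring `⨁ I ^ n / I ^ (n + 1)` of `I`, as the quotient
`R[It] / I R[It]` of the Rees algebra. -/
def GrRing (I : Ideal R) : Type _ :=
  reesAlgebra I ⧸ reesIdeal I

noncomputable instance (I : Ideal R) : CommRing (GrRing I) :=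
  inferInstanceAs (CommRing (reesAlgebra I ⧸ reesIdeal I))

/-- The quotient map from the Rees algebra to the associated graded ring. -/
noncomputable def GrRing.mk (I : Ideal R) : reesAlgebra I →+* GrRing I :=
  Ideal.Quotient.mk (reesIdeal I)

/-- The submodule `⨁ M_{n+1} t ^ n` of the module `⨁ M t ^ n` over the Rees algebra. -/
noncomputable def shiftSubmodule (F : I.Filtration M) :
    Submodule (reesAlgebra I) (PolynomialModule R M) :=
  Ideal.Filtration.submodule
    { N := fun n => F.N (n + 1)
      mono := fun n => F.mono (n + 1)
      smul_le := fun n => F.smul_le (n + 1) }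

/-- The associated graded module `⨁ M_n / M_{n+1}` of the filtration, as the quotient of
`⨁ M_n t ^ n` by `⨁ M_{n+1} t ^ n`. -/
def GrModule (F : I.Filtration M) : Type _ :=
  Subquotient (S := reesAlgebra I) F.submodule (shiftSubmodule F)

noncomputable instance (F : I.Filtration M) : AddCommGroup (GrModule F) :=
  inferInstanceAs (AddCommGroup (Subquotient (S := reesAlgebra I) F.submodule (shiftSubmodule F)))

noncomputable instance (F : I.Filtration M) : Module (reesAlgebra I) (GrModule F) :=
  inferInstanceAs (Module (reesAlgebra I)
    (Subquotient (S := reesAlgebra I) F.submodule (shiftSubmodule F)))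

theorem reesIdeal_smul_mem (F : I.Filtration M) :
    ∀ s ∈ reesIdeal I, ∀ x ∈ F.submodule, s • x ∈ shiftSubmodule F := by
  intro s hs x hx
  induction hs using Submodule.span_induction with
  | mem s hs =>
    obtain ⟨r, hr, rfl⟩ := hs
    intro i
    rw [algebraMap_smul]
    exact F.smul_le i (Submodule.smul_mem_smul hr (hx i))
  | zero => rw [zero_smul]; exact zero_mem _
  | add s t _ _ hs ht => rw [add_smul]; exact add_mem hs ht
  | smul s t _ ht => rw [smul_assoc]; exact Submodule.smul_mem _ s ht

theorem grModule_isTorsionBySet (F : I.Filtration M) :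
    Module.IsTorsionBySet (reesAlgebra I) (GrModule F) (reesIdeal I : Set (reesAlgebra I)) :=
  Subquotient.isTorsionBySet (S := reesAlgebra I) F.submodule (shiftSubmodule F) (reesIdeal I)
    (reesIdeal_smul_mem F)

/-- The associated graded module is a module over the associated graded ring. -/
noncomputable instance (F : I.Filtration M) : Module (GrRing I) (GrModule F) :=
  (grModule_isTorsionBySet F).module

theorem GrRing.mk_smul (F : I.Filtration M) (s : reesAlgebra I) (x : GrModule F) :
    GrRing.mk I s • x = s • x :=
  rfl

/-- The homogeneous maximal ideal of the associated graded ring of an ideal of a local ring: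
the classes of the elements of the Rees algebra whose component of degree `0` lies in the
maximal ideal. -/
noncomputable def grMaximalIdeal [IsLocalRing R] (I : Ideal R) : Ideal (GrRing I) :=
  ((maximalIdeal R).comap
    (Polynomial.constantCoeff.comp (reesAlgebra I).val.toRingHom)).map (GrRing.mk I)

/-- The depth of the `S`-module `G` with respect to the ideal `Q`: the supremum of the lengths of
the `G`-regular sequences in `Q`. -/
noncomputable def depth {S : Type*} [CommRing S] (Q : Ideal S)
    (G : Type*) [AddCommGroup G] [Module S G] : ℕ∞ :=
  ⨆ (rs : List S) (_ : (∀ s ∈ rs, s ∈ Q) ∧ RingTheory.Sequence.IsRegular G rs), (rs.length : ℕ∞)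

/-- The depth of the associated graded module of the filtration, with respect to the homogeneous
maximal ideal of the associated graded ring. -/
noncomputable def grDepth [IsLocalRing R] (F : I.Filtration M) : ℕ∞ :=
  depth (grMaximalIdeal I) (GrModule F)

end AssociatedGraded

end HilbertFiltration

/-! Let L(t) be the series of the lengths λ(M_{n+1}/J^{n+1}M). Computing λ(M_n/J^{n+1}M) through
M_{n+1} and through J^nM shows that the two Hilbert series differ by (t-1)L(t). So if L = g/(1-t)^d,
the difference of the second coefficients is g'(1) (`hilbertCoeff_two_sub`). Superficiality makes J
a reduction: JM_n = M_{n+1} for n ≥ n₀ (`IsSuperficialSequence.exists_smul_eq`). Hence the sum is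
finite, and g exists by Hilbert-Serre (`exists_pairSeries_mul_eq`).

For m ≥ n₀, the submodules J^{m+1-n}M_n with n ≤ n₀ form a chain from J^{m+1}M up to M_{m+1}, with
factors J^{m-n}M_{n+1}/J^{m-n}(JM_n). Filter M_{n+1}/JM_n by simple modules: each contributes a
graded quotient of the polynomial ring in d variables over the residue field, which is either the
whole ring or killed by a nonzero form. So the n-th factor has length r_n·binom(m-n+d-1, d-1) plus a
nonnegative error O(m^{d-2}), with r_n ≤ λ(M_{n+1}/JM_n) (`exists_length_pow_smul_bounds`).

Thus L - (∑ r_n t^n)/(1-t)^d has eventually nonnegative coefficients of order at most m^{d-2}. Its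
numerator p = g - ∑ r_n t^n then satisfies p(1) = 0 and p'(1) ≤ 0 (`derivative_eval_one_nonpos`),
that is, g'(1) ≤ ∑ n r_n ≤ ∑ n λ(M_{n+1}/JM_n). -/

namespace HilbertFiltration

/-! ### Lengths of subquotients -/

section Length

variable {R : Type*} [CommRing R] {P : Type*} [AddCommGroup P] [Module R P]

theorem subquotientLength_eq_length_of_surjective {A B : Submodule R P} {Q : Type*}
    [AddCommGroup Q] [Module R Q] (f : A →ₗ[R] Q) (hf : Function.Surjective f)
    (hker : LinearMap.ker f = B.submoduleOf A) : subquotientLength A B = Module.length R Q :=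
  ((Submodule.quotEquivOfEq _ _ hker.symm).trans (f.quotKerEquivOfSurjective hf)).length_eq

theorem subquotientLength_def (A B : Submodule R P) :
    subquotientLength A B = Module.length R (A ⧸ B.submoduleOf A) :=
  rfl

/-- The isomorphism theorem for the map induced by f. It is applied to multiplication by a ring
element and to evaluation of forms. -/
theorem subquotientLength_comap {P' : Type*} [AddCommGroup P'] [Module R P'] (f : P →ₗ[R] P')
    (A : Submodule R P) (B : Submodule R P') :
    subquotientLength A (B.comap f) = subquotientLength (A.map f) B := by
  rw [subquotientLength_def (A.map f)]
  refine subquotientLength_eq_length_of_surjective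
    ((B.submoduleOf (A.map f)).mkQ ∘ₗ f.submoduleMap A) ?_ ?_
  · exact (Submodule.mkQ_surjective _).comp (f.submoduleMap_surjective A)
  · rw [LinearMap.ker_comp, Submodule.ker_mkQ]
    rfl

theorem subquotientLength_sup_left (A B : Submodule R P) :
    subquotientLength (A ⊔ B) B = subquotientLength A B := by
  symm
  rw [subquotientLength_def (A ⊔ B)]
  refine subquotientLength_eq_length_of_surjective
    ((B.submoduleOf (A ⊔ B)).mkQ ∘ₗ Submodule.inclusion le_sup_left) ?_ ?_
  · intro y
    obtain ⟨⟨y, hy⟩, rfl⟩ := Submodule.mkQ_surjective _ y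
    obtain ⟨u, hu, v, hv, rfl⟩ := Submodule.mem_sup.1 hy
    refine ⟨⟨u, hu⟩, ?_⟩
    rw [LinearMap.comp_apply, ← sub_eq_zero, ← map_sub, Submodule.mkQ_apply,
      Submodule.Quotient.mk_eq_zero]
    simpa [Submodule.submoduleOf] using hv
  · rw [LinearMap.ker_comp, Submodule.ker_mkQ]
    rfl

theorem subquotientLength_inf_right (A B : Submodule R P) :
    subquotientLength A (A ⊓ B) = subquotientLength A B := by
  rw [subquotientLength_def A B]
  refine subquotientLength_eq_length_of_surjective ((B.submoduleOf A).mkQ)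
    (Submodule.mkQ_surjective _) ?_
  rw [Submodule.ker_mkQ]
  ext x
  simp [Submodule.submoduleOf]

theorem subquotientLength_add {A B C : Submodule R P} (hBA : B ≤ A) (hCB : C ≤ B) :
    subquotientLength A C = subquotientLength A B + subquotientLength B C := by
  have hinj : Function.Injective (Submodule.mapQ (C.submoduleOf B) (C.submoduleOf A)
      (Submodule.inclusion hBA) fun x hx => hx) := by
    rw [injective_iff_map_eq_zero]
    intro x hx
    obtain ⟨x, rfl⟩ := Submodule.mkQ_surjective _ x
    have h' : Submodule.inclusion hBA x ∈ C.submoduleOf A := (Submodule.Quotient.mk_eq_zero _).1 hx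
    exact (Submodule.Quotient.mk_eq_zero _).2 h'
  have hsurj : Function.Surjective (Submodule.mapQ (C.submoduleOf A) (B.submoduleOf A)
      LinearMap.id (fun x hx => hCB hx)) := by
    intro y
    obtain ⟨y, rfl⟩ := Submodule.mkQ_surjective _ y
    exact ⟨Submodule.Quotient.mk y, rfl⟩
  rw [add_comm]
  refine Module.length_eq_add_of_exact _ _ hinj hsurj ?_
  intro y
  obtain ⟨y, rfl⟩ := Submodule.mkQ_surjective _ y
  constructor
  · intro h
    have h' : y ∈ B.submoduleOf A := (Submodule.Quotient.mk_eq_zero _).1 h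
    exact ⟨Submodule.Quotient.mk ⟨y, h'⟩, rfl⟩
  · rintro ⟨z, hz⟩
    obtain ⟨z, rfl⟩ := Submodule.mkQ_surjective _ z
    rw [← hz]
    exact (Submodule.Quotient.mk_eq_zero _).2 z.2

theorem subquotientLength_eq_zero_iff {A B : Submodule R P} :
    subquotientLength A B = 0 ↔ A ≤ B := by
  rw [subquotientLength, Module.length_eq_zero_iff]
  exact Submodule.Quotient.subsingleton_iff.trans Submodule.comap_subtype_eq_top

theorem subquotientLength_eq_one_iff_simple {A B : Submodule R P} :
    subquotientLength A B = 1 ↔ IsSimpleModule R (A ⧸ B.submoduleOf A) :=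
  Module.length_eq_one_iff

theorem subquotientLength_ne_top_of_le {A B K : Submodule R P} (hK : subquotientLength ⊤ K ≠ ⊤)
    (hKB : K ≤ B) (hBA : B ≤ A) : subquotientLength A B ≠ ⊤ := by
  rw [subquotientLength_add le_top (hKB.trans hBA), subquotientLength_add hBA hKB] at hK
  intro h
  simp [h] at hK

/-- The length of `A / B` as a natural number, zero if the length is infinite. -/
noncomputable def natLength (A B : Submodule R P) : ℕ := (subquotientLength A B).toNat

theorem coe_natLength {A B : Submodule R P} (h : subquotientLength A B ≠ ⊤) :
    (natLength A B : ℕ∞) = subquotientLength A B :=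
  ENat.natCast_toNat h

theorem natLength_self (A : Submodule R P) : natLength A A = 0 := by
  rw [natLength, subquotientLength_eq_zero_iff.2 le_rfl]; rfl

theorem natLength_add {A B C : Submodule R P} (h : subquotientLength A C ≠ ⊤) (hBA : B ≤ A)
    (hCB : C ≤ B) : natLength A C = natLength A B + natLength B C := by
  rw [subquotientLength_add hBA hCB] at h
  have := WithTop.add_ne_top.1 h
  rw [natLength, subquotientLength_add hBA hCB, ENat.toNat_add this.1 this.2]
  rfl

/-- Multiplication by `x` from `A / B` to `A' / B'`: the lengths of its kernel and cokernel. -/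
theorem natLength_smul_exact (x : R) {A B A' B' : Submodule R P} (hB : B ≤ A) (hB' : B' ≤ A')
    (hA : A.map (LinearMap.lsmul R P x) ≤ A') (hx : B.map (LinearMap.lsmul R P x) ≤ B')
    (h : subquotientLength A B ≠ ⊤) (h' : subquotientLength A' B' ≠ ⊤) :
    natLength A B + natLength A' (A.map (LinearMap.lsmul R P x) ⊔ B') =
      natLength A' B' + natLength (A ⊓ B'.comap (LinearMap.lsmul R P x)) B := by
  have h1 := natLength_add h (B := A ⊓ B'.comap (LinearMap.lsmul R P x)) inf_le_left
    (le_inf hB (Submodule.map_le_iff_le_comap.1 hx))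
  have h2 := natLength_add h' (B := A.map (LinearMap.lsmul R P x) ⊔ B') (sup_le hA hB')
    le_sup_right
  -- Both sides are the length of the image of multiplication by x.
  have h3 : natLength A (A ⊓ B'.comap (LinearMap.lsmul R P x)) =
      natLength (A.map (LinearMap.lsmul R P x) ⊔ B') B' := by
    rw [natLength, natLength, subquotientLength_inf_right, subquotientLength_comap,
      subquotientLength_sup_left]
  omega

end Length

/-! ### Hilbert-Serre for quotients of filtrations -/

section HilbertSerre

variable {R : Type*} [CommRing R] {P : Type*} [AddCommGroup P] [Module R P] {J : Ideal R}

/-- The Hilbert series of `⨁ F_n / G_n`. -/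
noncomputable def pairSeries (F G : J.Filtration P) : PowerSeries ℤ :=
  PowerSeries.mk fun n => (natLength (F.N n) (G.N n) : ℤ)

/-- The filtration shifted by one. -/
def shiftFiltration (F : J.Filtration P) : J.Filtration P where
  N n := F.N (n + 1)
  mono n := F.mono (n + 1)
  smul_le n := F.smul_le (n + 1)

theorem shiftFiltration_stable {F : J.Filtration P} (hF : F.Stable) :
    (shiftFiltration F).Stable := by
  obtain ⟨n, hn⟩ := hF
  exact ⟨n, fun m hm => hn (m + 1) (by omega)⟩

/-- The filtration `{F_n ∩ (G_{n+1} : x)}`. -/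
def kernelFiltration (F G : J.Filtration P) (x : R) : J.Filtration P where
  N n := F.N n ⊓ (G.N (n + 1)).comap (LinearMap.lsmul R P x)
  mono n := inf_le_inf (F.mono n) (Submodule.comap_mono (G.mono (n + 1)))
  smul_le n := by
    rw [Submodule.smul_le]
    rintro r hr y ⟨hy, hy'⟩
    refine ⟨F.smul_le n (Submodule.smul_mem_smul hr hy), ?_⟩
    have := G.smul_le (n + 1) (Submodule.smul_mem_smul hr hy')
    simpa [smul_comm x r y] using this

/-- The filtration `{x F_n + G_{n+1}}`. -/
def imageFiltration (F G : J.Filtration P) (x : R) : J.Filtration P where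
  N n := (F.N n).map (LinearMap.lsmul R P x) ⊔ G.N (n + 1)
  mono n := sup_le_sup (Submodule.map_mono (F.mono n)) (G.mono (n + 1))
  smul_le n := by
    rw [Submodule.smul_sup, ← Submodule.map_smul'']
    exact sup_le_sup (Submodule.map_mono (F.smul_le n)) (G.smul_le (n + 1))

theorem map_lsmul_le_of_mem (F : J.Filtration P) {x : R} (hx : x ∈ J) (n : ℕ) :
    (F.N n).map (LinearMap.lsmul R P x) ≤ F.N (n + 1) := by
  rintro _ ⟨y, hy, rfl⟩
  exact F.smul_le n (Submodule.smul_mem_smul hx hy)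

/-- The **Hilbert-Serre theorem** for `⨁ F_n / G_n`, where `F` is a stable `J`-filtration and
`J` acts through the elements of the list `s`. -/
theorem exists_pairSeries_mul_eq [IsNoetherianRing R] [Module.Finite R P] (s : List R) :
    ∀ (F G : J.Filtration P), F.Stable → (∀ x ∈ s, x ∈ J) → (∀ n, G.N n ≤ F.N n) →
      (∀ n, subquotientLength (F.N n) (G.N n) ≠ ⊤) →
      (∃ K : Ideal R, J ≤ Ideal.span {x | x ∈ s} ⊔ K ∧ ∀ n, K • F.N n ≤ G.N (n + 1)) →
      ∃ p : Polynomial ℤ,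
        pairSeries F G * (1 - PowerSeries.X) ^ s.length = (p : PowerSeries ℤ) := by
  induction s with
  | nil =>
    rintro F G ⟨n₀, hn₀⟩ - - - ⟨K, hJK, hK⟩
    -- With no generators left, J ≤ K, so past n₀ stability gives F_{m+1} = JF_m ⊆ G_{m+1}: the
    -- series is a polynomial.
    refine ⟨(pairSeries F G).trunc (n₀ + 1), ?_⟩
    ext n
    rw [List.length_nil, pow_zero, mul_one, Polynomial.coeff_coe, PowerSeries.coeff_trunc]
    split_ifs with h
    · rfl
    · obtain ⟨m, rfl⟩ : ∃ m, n = m + 1 := ⟨n - 1, by omega⟩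
      have : F.N (m + 1) ≤ G.N (m + 1) := by
        rw [← hn₀ m (by omega)]
        exact (Submodule.smul_mono_left (by simpa using hJK)).trans (hK m)
      simp [pairSeries, natLength, subquotientLength_eq_zero_iff.2 this]
  | cons x s ih =>
    rintro F G hF hs hGF hfin ⟨K, hJK, hK⟩
    have hxJ : x ∈ J := hs x (by simp)
    have hsJ : ∀ y ∈ s, y ∈ J := fun y hy => hs y (by simp [hy])
    have hGK : ∀ n, G.N n ≤ (kernelFiltration F G x).N n := fun n =>
      le_inf (hGF n) (Submodule.map_le_iff_le_comap.1 (map_lsmul_le_of_mem G hxJ n))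
    -- Multiplication by x is zero on its own kernel and cokernel, so x moves from the list of
    -- generators into the annihilating ideal.
    have hJK' : J ≤ Ideal.span {y | y ∈ s} ⊔ (K ⊔ Ideal.span {x}) := by
      have : {y | y ∈ x :: s} = insert x {y | y ∈ s} := by ext; simp
      rw [this, Ideal.span_insert] at hJK
      exact hJK.trans (sup_le (sup_le (le_sup_of_le_right le_sup_right) le_sup_left)
        (le_sup_of_le_right le_sup_left))
    have hspan : ∀ A : Submodule R P,
        Ideal.span {x} • A = A.map (LinearMap.lsmul R P x) := fun A => by
      rw [Submodule.ideal_span_singleton_smul]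
      rfl
    obtain ⟨p, hp⟩ := ih (shiftFiltration F) (imageFiltration F G x) (shiftFiltration_stable hF)
      hsJ (fun n => sup_le (map_lsmul_le_of_mem F hxJ n) (hGF (n + 1)))
      (fun n h => hfin (n + 1) (by
        rw [subquotientLength_add (B := (imageFiltration F G x).N n)
          (sup_le (map_lsmul_le_of_mem F hxJ n) (hGF (n + 1))) le_sup_right]
        exact WithTop.add_eq_top.2 (Or.inl h)))
      ⟨_, hJK', fun n => by
        rw [Submodule.sup_smul, hspan]
        exact sup_le (le_sup_of_le_right (hK (n + 1))) le_sup_left⟩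
    obtain ⟨k, hk⟩ := ih (kernelFiltration F G x) G (hF.of_le fun n => inf_le_left) hsJ hGK
      (fun n h => hfin n (by
        rw [subquotientLength_add (B := (kernelFiltration F G x).N n) inf_le_left (hGK n)]
        exact WithTop.add_eq_top.2 (Or.inr h)))
      ⟨_, hJK', fun n => by
        rw [Submodule.sup_smul, hspan]
        exact sup_le ((smul_mono_right K inf_le_left).trans (hK n))
          (Submodule.map_le_iff_le_comap.2 inf_le_right)⟩
    refine ⟨Polynomial.X * (p - k) + Polynomial.C (natLength (F.N 0) (G.N 0) : ℤ) *
      (1 - Polynomial.X) ^ s.length, ?_⟩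
    -- Additivity of length along the kernel and cokernel of x : F_n/G_n → F_{n+1}/G_{n+1}. Degree 0
    -- is the target of no such map, hence the constant term.
    have key : pairSeries F G * (1 - PowerSeries.X) = PowerSeries.X *
        (pairSeries (shiftFiltration F) (imageFiltration F G x) -
          pairSeries (kernelFiltration F G x) G) +
        PowerSeries.C (natLength (F.N 0) (G.N 0) : ℤ) := by
      ext n
      rw [mul_sub, mul_one]
      cases n with
      | zero => simp [pairSeries]
      | succ n =>
        have := natLength_smul_exact x (hGF n) (hGF (n + 1)) (map_lsmul_le_of_mem F hxJ n)
          (map_lsmul_le_of_mem G hxJ n) (hfin n) (hfin (n + 1))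
        simp only [map_sub, map_add, PowerSeries.coeff_succ_mul_X, PowerSeries.coeff_succ_X_mul,
          pairSeries, PowerSeries.coeff_mk, PowerSeries.coeff_C]
        simp only [shiftFiltration, imageFiltration, kernelFiltration]
        simp
        omega
    rw [List.length_cons, pow_succ', ← mul_assoc, key]
    push_cast
    rw [← hp, ← hk]
    ring

end HilbertSerre

/-! ### Signs of numerators from signs of coefficients -/

section PowerSeries

/-- For a single factor 1/(1-t) the coefficients are partial sums of those of p, eventually equal to
p(1). Each further factor sums a sequence that is eventually at most -1, so the sums become
negative. -/
theorem coeff_eventually_neg_of_eval_one_neg (d : ℕ) :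
    ∀ {S : PowerSeries ℤ} {p : Polynomial ℤ},
      S * (1 - PowerSeries.X) ^ (d + 1) = (p : PowerSeries ℤ) → p.eval 1 < 0 →
      ∃ n₀, ∀ n ≥ n₀, PowerSeries.coeff n S < 0 := by
  induction d with
  | zero =>
    intro S p h hp
    have key : ∀ n, PowerSeries.coeff n S = ∑ i ∈ Finset.range (n + 1), p.coeff i := by
      intro n
      rw [zero_add, pow_one, mul_sub, mul_one] at h
      induction n with
      | zero =>
        have := congrArg (PowerSeries.coeff 0) h
        simpa using this
      | succ n ih =>
        have := congrArg (PowerSeries.coeff (n + 1)) h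
        rw [map_sub, PowerSeries.coeff_succ_mul_X, Polynomial.coeff_coe, ih] at this
        rw [Finset.sum_range_succ, ← this]
        ring
    refine ⟨p.natDegree, fun n hn => ?_⟩
    rw [key]
    rw [Polynomial.eval_eq_sum_range' (n := n + 1) (by omega)] at hp
    simpa using hp
  | succ d ih =>
    intro S p h hp
    obtain ⟨n₀, hn₀⟩ := ih (S := S * (1 - PowerSeries.X)) (p := p)
      (by rw [← h]; ring) hp
    have step : ∀ n, PowerSeries.coeff (n₀ + n) S ≤ PowerSeries.coeff n₀ S - n := by
      intro n
      induction n with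
      | zero => simp
      | succ n ihn =>
        have := hn₀ (n₀ + n + 1) (by omega)
        rw [mul_sub, mul_one, map_sub, PowerSeries.coeff_succ_mul_X] at this
        push_cast
        rw [← add_assoc]
        omega
    refine ⟨n₀ + (PowerSeries.coeff n₀ S).natAbs + 1, fun n hn => ?_⟩
    obtain ⟨m, rfl⟩ : ∃ m, n = n₀ + m := ⟨n - n₀, by omega⟩
    have := step m
    omega

theorem eval_one_nonneg_of_coeff_eventually_nonneg {d : ℕ} (hd : 0 < d) {S : PowerSeries ℤ}
    {p : Polynomial ℤ} (h : S * (1 - PowerSeries.X) ^ d = (p : PowerSeries ℤ))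
    (hS : ∃ n₀, ∀ n ≥ n₀, 0 ≤ PowerSeries.coeff n S) : 0 ≤ p.eval 1 := by
  obtain ⟨d, rfl⟩ : ∃ e, d = e + 1 := ⟨d - 1, by omega⟩
  by_contra! hp
  obtain ⟨n₀, hn₀⟩ := hS
  obtain ⟨n₁, hn₁⟩ := coeff_eventually_neg_of_eval_one_neg d h hp
  have h1 := hn₀ (max n₀ n₁) (le_max_left _ _)
  have h2 := hn₁ (max n₀ n₁) (le_max_right _ _)
  omega

/-- If the coefficients of `p / (1 - t) ^ (d + 2)` are nonnegative and of order at most `n ^ d`,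
then `p(1) = 0` and `p'(1) ≤ 0`. -/
theorem derivative_eval_one_nonpos {d c : ℕ} {S : PowerSeries ℤ} {p : Polynomial ℤ}
    (h : S * (1 - PowerSeries.X) ^ (d + 2) = (p : PowerSeries ℤ))
    (hS : ∃ n₀, ∀ n ≥ n₀, 0 ≤ PowerSeries.coeff n S ∧
      PowerSeries.coeff n S ≤ c * ((d + n).choose d : ℤ)) :
    p.derivative.eval 1 ≤ 0 := by
  obtain ⟨n₀, hn₀⟩ := hS
  have h1 := eval_one_nonneg_of_coeff_eventually_nonneg (by omega) h ⟨n₀, fun n hn => (hn₀ n hn).1⟩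
  set B : PowerSeries ℤ := PowerSeries.mk fun n => ((d + n).choose d : ℤ) with hB
  have hBm : B * (1 - PowerSeries.X) ^ (d + 1) = 1 :=
    PowerSeries.mk_add_choose_mul_one_sub_pow_eq_one ℤ d
  -- The series c/(1-t)^{d+1} - S is eventually nonnegative by the upper bound, and its numerator
  -- takes the value -p(1) at 1.
  have h2 := eval_one_nonneg_of_coeff_eventually_nonneg (d := d + 2) (by omega)
    (S := PowerSeries.C (c : ℤ) * B - S)
    (p := Polynomial.C (c : ℤ) * (1 - Polynomial.X) - p)
    (by
      push_cast
      rw [← h, sub_mul, pow_succ _ (d + 1)]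
      linear_combination (PowerSeries.C (c : ℤ) * (1 - PowerSeries.X)) * hBm)
    ⟨n₀, fun n hn => by
      have := (hn₀ n hn).2
      rw [map_sub, ← PowerSeries.smul_eq_C_mul, map_smul, hB, PowerSeries.coeff_mk, smul_eq_mul]
      omega⟩
  have hp1 : p.eval 1 = 0 := by
    simp at h2
    omega
  -- With p = (t-1)s one has S = -s/(1-t)^{d+1} and p'(1) = s(1).
  obtain ⟨s, hs⟩ := Polynomial.dvd_iff_isRoot.2 hp1
  have hs' : S * (1 - PowerSeries.X) ^ (d + 1) = ((-s : Polynomial ℤ) : PowerSeries ℤ) := by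
    have hne : (1 - PowerSeries.X : PowerSeries ℤ) ≠ 0 := fun h0 => by
      have := congrArg PowerSeries.constantCoeff h0
      simp at this
    refine mul_right_cancel₀ hne ?_
    rw [mul_assoc, ← pow_succ, h, hs]
    push_cast
    simp
    ring
  have h3 := eval_one_nonneg_of_coeff_eventually_nonneg (by omega) hs'
    ⟨n₀, fun n hn => (hn₀ n hn).1⟩
  rw [hs]
  simp at h3 ⊢
  exact h3

end PowerSeries

/-! ### Growth of λ(J^k A / J^k B) -/

section Growth

/-- Pascal's rule e times, each step costing at most binom(k+d, d). It bounds the Hilbert function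
of a polynomial ring modulo a form of degree e. -/
theorem choose_le_choose_sub_add (d : ℕ) (e : ℕ) : ∀ k ≥ e,
    (k + d + 1).choose (d + 1) ≤ (k - e + d + 1).choose (d + 1) + e * (k + d).choose d := by
  induction e with
  | zero => simp
  | succ e ih =>
    intro k hk
    have h1 := ih k (by omega)
    obtain ⟨j, rfl⟩ : ∃ j, k = j + e + 1 := ⟨k - e - 1, by omega⟩
    rw [show j + e + 1 - e = j + 1 by omega] at h1
    rw [show j + e + 1 - (e + 1) = j by omega, add_mul, one_mul]
    have h2 : (j + 1 + d + 1).choose (d + 1) = (j + 1 + d).choose d + (j + d + 1).choose (d + 1) := by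
      rw [Nat.choose_succ_succ, show j + 1 + d = j + d + 1 by ring]
    have h3 : (j + 1 + d).choose d ≤ (j + e + 1 + d).choose d := Nat.choose_le_choose _ (by omega)
    omega

variable {R : Type*} [CommRing R] {P : Type*} [AddCommGroup P] [Module R P]

theorem subquotientLength_mono_left {A A' : Submodule R P} (h : A ≤ A') (B : Submodule R P) :
    subquotientLength A B ≤ subquotientLength A' B := by
  rw [← subquotientLength_sup_left A, ← subquotientLength_sup_left A',
    subquotientLength_add (sup_le_sup_right h B) le_sup_right]
  exact le_add_self

variable {d : ℕ}

/-- The evaluation `f ↦ f(a) x`. -/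
noncomputable def evalSmul (a : Fin d → R) (x : P) : MvPolynomial (Fin d) R →ₗ[R] P :=
  (LinearMap.toSpanSingleton R P x) ∘ₗ (MvPolynomial.aeval a).toLinearMap

theorem evalSmul_apply (a : Fin d → R) (x : P) (f : MvPolynomial (Fin d) R) :
    evalSmul a x f = MvPolynomial.aeval a f • x :=
  rfl

theorem map_evalSmul_homogeneousSubmodule (a : Fin d → R) (x : P) (k : ℕ) :
    (MvPolynomial.homogeneousSubmodule (Fin d) R k).map (evalSmul a x) =
      Ideal.span (Set.range a) ^ k • (R ∙ x) := by
  rw [evalSmul, Submodule.map_comp, ← Ideal.span_pow_eq_map_homogeneousSubmodule]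
  ext y
  rw [Submodule.mem_smul_span_singleton]
  simp

/-- Evaluation at a maps the forms of degree k onto J^k x, which together with J^k B makes up J^k A.
-/
theorem subquotientLength_pow_smul_eq (a : Fin d → R) {A B : Submodule R P} {x : P}
    (hA : A = (R ∙ x) ⊔ B) (k : ℕ) :
    subquotientLength (Ideal.span (Set.range a) ^ k • A) (Ideal.span (Set.range a) ^ k • B) =
      subquotientLength (MvPolynomial.homogeneousSubmodule (Fin d) R k)
        ((Ideal.span (Set.range a) ^ k • B).comap (evalSmul a x)) := by
  rw [hA, Submodule.smul_sup, subquotientLength_sup_left, subquotientLength_comap,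
    map_evalSmul_homogeneousSubmodule]

/-- The polynomials with coefficients in the maximal ideal. -/
def residueKernel (R : Type*) [CommRing R] [IsLocalRing R] (d : ℕ) :
    Submodule R (MvPolynomial (Fin d) R) where
  carrier := {f | ∀ m, f.coeff m ∈ maximalIdeal R}
  zero_mem' m := by simp
  add_mem' hf hg m := by
    rw [MvPolynomial.coeff_add]
    exact add_mem (hf m) (hg m)
  smul_mem' r f hf m := by
    rw [MvPolynomial.coeff_smul]
    exact Ideal.mul_mem_left _ r (hf m)

variable [IsLocalRing R]

theorem mem_residueKernel_iff_map_eq_zero {f : MvPolynomial (Fin d) R} :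
    f ∈ residueKernel R d ↔ MvPolynomial.map (residue R) f = 0 := by
  simp only [MvPolynomial.ext_iff, MvPolynomial.coeff_map, MvPolynomial.coeff_zero,
    residue_eq_zero_iff]
  rfl

/-- Reduction of coefficients lands in a polynomial ring over a field, which is a domain. -/
theorem mul_mem_residueKernel_iff {f g : MvPolynomial (Fin d) R} (hf : f ∉ residueKernel R d) :
    f * g ∈ residueKernel R d ↔ g ∈ residueKernel R d := by
  rw [mem_residueKernel_iff_map_eq_zero] at hf
  simp only [mem_residueKernel_iff_map_eq_zero, map_mul, mul_eq_zero, hf, false_or]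

/-- Reading off coefficients modulo the maximal ideal gives one copy of the residue field for each
monomial of degree k in d + 1 variables. -/
theorem subquotientLength_homogeneousSubmodule (d k : ℕ) :
    subquotientLength (MvPolynomial.homogeneousSubmodule (Fin (d + 1)) R k)
      (residueKernel R (d + 1)) = ((k + d).choose d : ℕ) := by
  classical
  let s := (Finset.univ : Finset (Fin (d + 1))).finsuppAntidiag k
  have hs : ∀ m : Fin (d + 1) →₀ ℕ, m ∈ s ↔ m.degree = k := fun m => by
    simp [s, Finsupp.degree_eq_sum]
  let f : MvPolynomial.homogeneousSubmodule (Fin (d + 1)) R k →ₗ[R] (s → ResidueField R) :=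
    LinearMap.pi fun m => (Algebra.linearMap R (ResidueField R)) ∘ₗ
      (MvPolynomial.lcoeff R m.1) ∘ₗ Submodule.subtype _
  have hf : ∀ p m, f p m = residue R (p.1.coeff m.1) := fun p m => rfl
  rw [subquotientLength_eq_length_of_surjective f]
  · have h1 : Module.length R (ResidueField R) = 1 := by
      rw [Module.length_eq_one_iff, isSimpleModule_iff_quot_maximal]
      exact ⟨maximalIdeal R, inferInstance, ⟨LinearEquiv.refl R _⟩⟩
    rw [Module.length_pi, h1, mul_one, ENat.card_eq_coe_fintype_card, Fintype.card_coe,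
      Finset.card_finsuppAntidiag_nat_eq_choose, Finset.card_univ, Fintype.card_fin,
      show d + 1 + k - 1 = k + d by omega, Nat.choose_symm_add]
  · intro y
    choose z hz using fun m => residue_surjective (y m)
    refine ⟨⟨∑ m : s, MvPolynomial.monomial m.1 (z m), ?_⟩, ?_⟩
    · refine Submodule.sum_mem _ fun m _ => ?_
      exact MvPolynomial.isHomogeneous_monomial _ ((hs m).1 m.2)
    · ext m
      rw [hf, ← hz]
      congr 1
      rw [MvPolynomial.coeff_sum, Finset.sum_eq_single m]
      · simp
      · intro b _ hb
        rw [MvPolynomial.coeff_monomial, if_neg fun h => hb (Subtype.ext h)]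
      · simp
  · ext p
    rw [LinearMap.mem_ker]
    constructor
    · intro h m
      by_cases hm : m ∈ s
      · have := congrFun h ⟨m, hm⟩
        rw [hf] at this
        exact (residue_eq_zero_iff _).1 this
      · have : p.1.coeff m = 0 := by
          by_contra h0
          exact hm ((hs m).2 (by
            have := p.2 h0
            rwa [Pi.one_def, ← Finsupp.degree_eq_weight_one] at this))
        change MvPolynomial.coeff m p.1 ∈ _
        simp [this]
    · intro h
      ext m
      rw [hf]
      exact (residue_eq_zero_iff _).2 (h m.1)

theorem evalSmul_mem_of_mem_residueKernel (a : Fin d → R) {B : Submodule R P} {x : P}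
    (hx : ∀ r ∈ maximalIdeal R, r • x ∈ B) {k : ℕ} {f : MvPolynomial (Fin d) R}
    (hf : f.IsHomogeneous k) (hf' : f ∈ residueKernel R d) :
    evalSmul a x f ∈ Ideal.span (Set.range a) ^ k • B := by
  rw [evalSmul_apply, MvPolynomial.aeval_def, MvPolynomial.eval₂_eq, Finset.sum_smul]
  refine Submodule.sum_mem _ fun m hm => ?_
  rw [Algebra.algebraMap_self, RingHom.id_apply, mul_comm, mul_smul]
  refine Submodule.smul_mem_smul ?_ (hx _ (hf' m))
  rw [Ideal.mem_span_pow_iff_exists_isHomogeneous]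
  refine ⟨MvPolynomial.monomial m 1, MvPolynomial.isHomogeneous_monomial _ ?_, ?_⟩
  · have := hf (MvPolynomial.mem_support_iff.1 hm)
    rwa [Pi.one_def, ← Finsupp.degree_eq_weight_one] at this
  · rw [MvPolynomial.eval_monomial, one_mul, Finsupp.prod]

/-- Modulo the maximal ideal, the forms f with f(a)x ∈ J^k B make up a homogeneous ideal. If it is
zero, all forms survive. If it contains a nonzero form of degree e, its multiples fill a copy of the
forms of degree k - e in degree k. -/
theorem length_pow_smul_dichotomy (a : Fin (d + 1) → R) {A B : Submodule R P} {x : P}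
    (hA : A = (R ∙ x) ⊔ B) (hx : ∀ r ∈ maximalIdeal R, r • x ∈ B) :
    (∀ k, subquotientLength (Ideal.span (Set.range a) ^ k • A) (Ideal.span (Set.range a) ^ k • B) =
      ((k + d).choose d : ℕ)) ∨
    ∃ e, ∀ k ≥ e,
      subquotientLength (Ideal.span (Set.range a) ^ k • A) (Ideal.span (Set.range a) ^ k • B) +
        ((k - e + d).choose d : ℕ) ≤ ((k + d).choose d : ℕ) := by
  set J := Ideal.span (Set.range a) with hJ
  let S := MvPolynomial.homogeneousSubmodule (Fin (d + 1)) R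
  have hle : ∀ k, S k ⊓ residueKernel R (d + 1) ≤ S k ⊓ (J ^ k • B).comap (evalSmul a x) :=
    fun k f hf => ⟨hf.1, evalSmul_mem_of_mem_residueKernel a hx hf.1 hf.2⟩
  have hlen : ∀ k, subquotientLength (J ^ k • A) (J ^ k • B) =
      subquotientLength (S k) (S k ⊓ (J ^ k • B).comap (evalSmul a x)) := fun k => by
    rw [subquotientLength_inf_right]
    exact subquotientLength_pow_smul_eq a hA k
  by_cases hcase : ∀ k, S k ⊓ (J ^ k • B).comap (evalSmul a x) ≤ residueKernel R (d + 1)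
  · left
    intro k
    rw [hlen, ← subquotientLength_homogeneousSubmodule (R := R) d k,
      ← subquotientLength_inf_right _ (residueKernel R (d + 1)),
      le_antisymm (le_inf inf_le_left (hcase k)) (hle k)]
  · right
    push Not at hcase
    obtain ⟨e, he⟩ := hcase
    obtain ⟨f, hf, hf'⟩ := SetLike.not_le_iff_exists.1 he
    refine ⟨e, fun k hk => ?_⟩
    have h1 := subquotientLength_add (A := S k) inf_le_left (hle k)
    rw [subquotientLength_inf_right, subquotientLength_homogeneousSubmodule] at h1
    rw [hlen, h1, ← subquotientLength_homogeneousSubmodule (R := R) d (k - e)]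
    refine add_le_add_right ?_ _
    have hcomap : residueKernel R (d + 1) =
        (residueKernel R (d + 1)).comap (LinearMap.mulLeft R f) := by
      ext g
      exact (mul_mem_residueKernel_iff hf').symm
    nth_rw 1 [hcomap]
    rw [subquotientLength_comap]
    have hmap : (S (k - e)).map (LinearMap.mulLeft R f) ≤
        S k ⊓ (J ^ k • B).comap (evalSmul a x) := by
      rintro _ ⟨g, hg, rfl⟩
      have hke : k = e + (k - e) := by omega
      constructor
      · rw [hke]
        exact MvPolynomial.IsHomogeneous.mul hf.1 hg
      · change evalSmul a x (f * g) ∈ J ^ k • B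
        rw [evalSmul_apply, map_mul, mul_comm,
          mul_smul, hke, add_comm, pow_add, Submodule.mul_smul]
        refine Submodule.smul_mem_smul ?_ hf.2
        rw [hJ, Ideal.mem_span_pow_iff_exists_isHomogeneous]
        exact ⟨g, hg, rfl⟩
    refine (subquotientLength_mono_left hmap _).trans ?_
    rw [← subquotientLength_inf_right _ (residueKernel R (d + 1)),
      ← subquotientLength_inf_right _ (S k ⊓ residueKernel R (d + 1)), ← inf_assoc,
      inf_eq_left.2 (inf_le_left : S k ⊓ (J ^ k • B).comap (evalSmul a x) ≤ S k)]

/-- Peel off a simple quotient A/A' and induct on the length. The number r counts the simple factors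
that yield a full polynomial ring; every other factor contributes only to the lower-order term. -/
theorem exists_length_pow_smul_bounds [IsNoetherian R P] (a : Fin (d + 2) → R) (v : ℕ) :
    ∀ {A B : Submodule R P}, B ≤ A → subquotientLength A B = v →
    ∃ r ≤ v, ∃ c e : ℕ, ∀ k ≥ e,
      ((r * (k + d + 1).choose (d + 1) : ℕ) : ℕ∞) ≤
        subquotientLength (Ideal.span (Set.range a) ^ k • A) (Ideal.span (Set.range a) ^ k • B) ∧
      subquotientLength (Ideal.span (Set.range a) ^ k • A) (Ideal.span (Set.range a) ^ k • B) ≤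
        ((r * (k + d + 1).choose (d + 1) + c * (k + d).choose d : ℕ) : ℕ∞) := by
  induction v with
  | zero =>
    intro A B hBA h
    have : A = B := le_antisymm (subquotientLength_eq_zero_iff.1 (by simpa using h)) hBA
    refine ⟨0, le_rfl, 0, 0, fun k _ => ?_⟩
    rw [this, subquotientLength_eq_zero_iff.2 le_rfl]
    simp
  | succ v ih =>
    intro A B hBA h
    have hlt : B < A := lt_of_le_of_ne hBA fun hBA' => by
      rw [subquotientLength_eq_zero_iff.2 hBA'.ge] at h
      exact absurd h (by exact_mod_cast (Nat.succ_ne_zero v).symm)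
    obtain ⟨A', ⟨hBA', hA'⟩, hmax⟩ := wellFounded_gt.has_min {A' | B ≤ A' ∧ A' < A} ⟨B, le_rfl, hlt⟩
    have hcov : A' ⋖ A := ⟨hA', fun C h1 h2 => hmax C ⟨hBA'.trans h1.le, h2⟩ h1⟩
    have hsimple : IsSimpleModule R (A ⧸ A'.submoduleOf A) := (covBy_iff_quot_is_simple hA'.le).1 hcov
    have hone : subquotientLength A A' = 1 := subquotientLength_eq_one_iff_simple.2 hsimple
    have hv : subquotientLength A' B = v := by
      rw [subquotientLength_add hA'.le hBA', hone, add_comm] at h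
      push_cast at h
      exact WithTop.add_right_cancel WithTop.one_ne_top h
    obtain ⟨r, hr, c, e, hk⟩ := ih hBA' hv
    obtain ⟨x, hxA, hxA'⟩ := SetLike.exists_of_lt hA'
    have hspan : A = (R ∙ x) ⊔ A' := by
      refine (hcov.eq_or_eq le_sup_right (sup_le ?_ hA'.le)).resolve_left (fun h0 => ?_) |>.symm
      · exact (Submodule.span_singleton_le_iff_mem _ _).2 hxA
      · exact hxA' (h0 ▸ Submodule.mem_sup_left (Submodule.mem_span_singleton_self x))
    have hx : ∀ r ∈ maximalIdeal R, r • x ∈ A' := by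
      intro r hr
      have hann := IsSimpleModule.annihilator_isMaximal (R := R) (M := A ⧸ A'.submoduleOf A)
      rw [← eq_maximalIdeal hann, Module.mem_annihilator] at hr
      have := hr ((A'.submoduleOf A).mkQ ⟨x, hxA⟩)
      rw [← map_smul, Submodule.mkQ_apply, Submodule.Quotient.mk_eq_zero] at this
      exact this
    have hadd : ∀ k, subquotientLength (Ideal.span (Set.range a) ^ k • A)
        (Ideal.span (Set.range a) ^ k • B) =
        subquotientLength (Ideal.span (Set.range a) ^ k • A) (Ideal.span (Set.range a) ^ k • A') +
        subquotientLength (Ideal.span (Set.range a) ^ k • A') (Ideal.span (Set.range a) ^ k • B) :=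
      fun k => subquotientLength_add (smul_mono_right _ hA'.le) (smul_mono_right _ hBA')
    rcases length_pow_smul_dichotomy a hspan hx with h1 | ⟨e', h1⟩
    · simp only [← add_assoc] at h1
      refine ⟨r + 1, by omega, c, e, fun k hke => ?_⟩
      rw [hadd, h1]
      obtain ⟨h2, h3⟩ := hk k hke
      constructor
      · refine le_trans (le_of_eq ?_) (add_le_add_right h2 _)
        push_cast
        ring
      · refine le_trans (add_le_add_right h3 _) (le_of_eq ?_)
        push_cast
        ring
    · refine ⟨r, by omega, c + e', max e e', fun k hke => ?_⟩
      rw [hadd]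
      obtain ⟨h2, h3⟩ := hk k (le_trans (le_max_left _ _) hke)
      have h4 := h1 k (le_trans (le_max_right _ _) hke)
      have h5 := choose_le_choose_sub_add d e' k (le_trans (le_max_right _ _) hke)
      have h6 : subquotientLength (Ideal.span (Set.range a) ^ k • A)
          (Ideal.span (Set.range a) ^ k • A') ≤ (e' * (k + d).choose d : ℕ) := by
        have : subquotientLength (Ideal.span (Set.range a) ^ k • A)
          (Ideal.span (Set.range a) ^ k • A') ≠ ⊤ := fun h0 => by simp [h0] at h4
        lift subquotientLength (Ideal.span (Set.range a) ^ k • A)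
          (Ideal.span (Set.range a) ^ k • A') to ℕ using this with l
        norm_cast at h4 ⊢
        simp only [← add_assoc] at h4
        omega
      refine ⟨h2.trans le_add_self, (add_le_add h6 h3).trans (le_of_eq ?_)⟩
      push_cast
      ring

end Growth

/-! ### Finite length modulo powers of q -/

section FiniteLength

variable {R : Type*} [CommRing R] [IsNoetherianRing R] [IsLocalRing R]
  {M : Type*} [AddCommGroup M] [Module R M] [Module.Finite R M] {q : Ideal R}

/-- For n > 0 the maximal ideal is minimal over q^n, so R/q^n is Artinian and M/q^nM is finite over
it. -/
theorem subquotientLength_top_pow_smul_ne_top (hq : q.radical = maximalIdeal R) (n : ℕ) :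
    subquotientLength (⊤ : Submodule R M) (q ^ n • ⊤) ≠ ⊤ := by
  rcases Nat.eq_zero_or_pos n with rfl | hn
  · rw [pow_zero, one_smul, subquotientLength_eq_zero_iff.2 le_rfl]
    exact ENat.zero_ne_top
  have hrad : (q ^ n).radical = maximalIdeal R := by rw [Ideal.radical_pow q hn.ne', hq]
  have hmin : maximalIdeal R ∈ (q ^ n).minimalPrimes :=
    ⟨⟨inferInstance, hrad ▸ Ideal.le_radical⟩, fun p hp _ =>
      hrad ▸ (Ideal.IsPrime.radical_le_iff hp.1).2 hp.2⟩
  have := IsLocalRing.quotient_artinian_of_mem_minimalPrimes_of_isLocalRing _ hmin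
  have : Module.Finite (R ⧸ q ^ n) (M ⧸ (q ^ n • ⊤ : Submodule R M)) :=
    Module.Finite.of_restrictScalars_finite R _ _
  have hfin : Module.length R (M ⧸ (q ^ n • ⊤ : Submodule R M)) ≠ ⊤ := by
    rw [Module.length_eq_of_surjective (R := R ⧸ q ^ n) Ideal.Quotient.mk_surjective]
    exact Module.length_ne_top
  rwa [subquotientLength_eq_length_of_surjective
    ((q ^ n • ⊤ : Submodule R M).mkQ ∘ₗ (⊤ : Submodule R M).subtype)]
  · exact (Submodule.mkQ_surjective _).comp fun x => ⟨⟨x, trivial⟩, rfl⟩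
  · rw [LinearMap.ker_comp, Submodule.ker_mkQ]
    rfl

end FiniteLength

/-! ### Superficial elements -/

section Superficial

variable {R : Type*} [CommRing R] {M : Type*} [AddCommGroup M] [Module R M] {q : Ideal R}

theorem IsGood.quotientFiltration {F : q.Filtration M} (hF : IsGood F) (N : Submodule R M) :
    IsGood (quotientFiltration F N) where
  zero_eq_top := by
    change (F.N 0).map N.mkQ = ⊤
    rw [hF.zero_eq_top, Submodule.map_top, Submodule.range_mkQ]
  stable := by
    obtain ⟨n, hn⟩ := hF.stable
    refine ⟨n, fun m hm => ?_⟩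
    change q • (F.N m).map N.mkQ = (F.N (m + 1)).map N.mkQ
    rw [← hn m hm, Submodule.map_smul'']

theorem IsGood.pow_smul_top_le {F : q.Filtration M} (hF : IsGood F) (n : ℕ) :
    q ^ n • ⊤ ≤ F.N n := by
  simpa [hF.zero_eq_top] using F.pow_smul_le n 0

theorem IsGood.exists_le_pow_smul_top {F : q.Filtration M} (hF : IsGood F) :
    ∃ n₀, ∀ n, F.N (n₀ + n) ≤ q ^ n • ⊤ := by
  obtain ⟨n₀, hn₀⟩ := hF.stable.exists_pow_smul_eq
  exact ⟨n₀, fun n => (hn₀ n).le.trans (smul_mono_right _ le_top)⟩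

variable [IsNoetherianRing R] [Module.Finite R M]

/-- By Artin-Rees, an element of bM deep enough in the filtration is by with y ∈ F_c; superficiality
then puts y in F_n. -/
theorem IsSuperficial.exists_inf_range_le {F : q.Filtration M} (hF : IsGood F) {b : R}
    (hb : IsSuperficial F b) : ∃ n₀, ∀ n ≥ n₀,
      F.N (n + 1) ⊓ LinearMap.range (LinearMap.lsmul R M b) ≤
        (F.N n).map (LinearMap.lsmul R M b) := by
  obtain ⟨-, c, hc⟩ := hb
  obtain ⟨k, hk⟩ := (hF.stable.inter_right
    (q.trivialFiltration (LinearMap.range (LinearMap.lsmul R M b)))).exists_pow_smul_eq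
  have hk' : ∀ j, F.N (k + j) ⊓ LinearMap.range (LinearMap.lsmul R M b) ≤
      (F.N j).map (LinearMap.lsmul R M b) := fun j => by
    refine (hk j).le.trans ((smul_mono_right _ inf_le_right).trans ?_)
    change q ^ j • LinearMap.range (LinearMap.lsmul R M b) ≤ _
    rw [LinearMap.range_eq_map, ← Submodule.map_smul'']
    exact Submodule.map_mono (hF.pow_smul_top_le j)
  refine ⟨k + c, fun n hn => ?_⟩
  rintro x ⟨hx, hx'⟩
  have hx₂ : x ∈ F.N (k + c) := F.antitone (show k + c ≤ n + 1 by omega) hx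
  obtain ⟨y, hy, rfl⟩ := hk' c ⟨hx₂, hx'⟩
  refine ⟨y, ?_, rfl⟩
  rw [SetLike.mem_coe, ← hc n (by omega)]
  exact ⟨hx, hy⟩

variable [IsLocalRing R]

/-- A minimal prime p is the annihilator of some x. If b ∈ p, then b kills q^c x ⊆ F_c. By
superficiality, elements of F_c killed by b lie in every F_n, hence vanish by Krull's intersection
theorem. So q^c ⊆ p, p is maximal, and M has dimension zero. -/
theorem IsSuperficial.notMem_of_mem_minimalPrimes (hq : q.radical = maximalIdeal R)
    {F : q.Filtration M} (hF : IsGood F) {b : R} (hb : IsSuperficial F b)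
    (hdim : Module.supportDim R M ≠ 0) :
    ∀ p ∈ (Module.annihilator R M).minimalPrimes, b ∉ p := by
  intro p hp hbp
  obtain ⟨hp', x, hx⟩ := isAssociatedPrime_iff.1
    (Module.associatedPrimes.minimalPrimes_annihilator_subset_associatedPrimes R M hp)
  obtain ⟨-, c, hc⟩ := hb
  have hbx : b • x = 0 := by
    rw [hx] at hbp
    simpa [Submodule.mem_colon_singleton] using hbp
  have hqt : q ≠ ⊤ := fun h => by
    rw [h, Ideal.radical_top] at hq
    exact (maximalIdeal.isMaximal R).ne_top hq.symm
  obtain ⟨n₀, hn₀⟩ := hF.exists_le_pow_smul_top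
  have hzero : ∀ y ∈ F.N c, b • y = 0 → y = 0 := by
    intro y hy hby
    have hmem : ∀ n, y ∈ F.N (c + n) := fun n => by
      rw [← hc (c + n) (by omega)]
      refine ⟨?_, hy⟩
      change b • y ∈ F.N (c + n + 1)
      rw [hby]
      exact zero_mem _
    rw [← Submodule.mem_bot R, ← q.iInf_pow_smul_eq_bot_of_isLocalRing (M := M) hqt,
      Submodule.mem_iInf]
    intro i
    exact hn₀ i (F.antitone (by omega) (hmem (n₀ + i)))
  have hqp : q ^ c ≤ p := by
    intro r hr
    rw [hx, Submodule.mem_colon_singleton, Submodule.mem_bot]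
    refine hzero _ (hF.pow_smul_top_le c (Submodule.smul_mem_smul hr trivial)) ?_
    rw [smul_comm, hbx, smul_zero]
  have hpm : p = maximalIdeal R := by
    refine le_antisymm (le_maximalIdeal hp'.ne_top) ?_
    rw [← hq]
    refine (hp'.radical_le_iff).2 ?_
    intro r hr
    exact hp'.mem_of_pow_mem c (hqp (Ideal.pow_mem_pow hr c))
  apply hdim
  have hsupp : ∀ s ∈ Module.support R M, s.asIdeal = maximalIdeal R := by
    intro s hs
    rw [Module.mem_support_iff_of_finite] at hs
    exact le_antisymm (le_maximalIdeal s.2.ne_top) (hpm ▸ hp.2 ⟨s.2, hs⟩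
      (hpm ▸ le_maximalIdeal s.2.ne_top))
  have : Nonempty (Module.support R M) :=
    ⟨⟨⟨p, hp'⟩, Module.mem_support_iff_of_finite.2 hp.1.2⟩⟩
  have : Subsingleton (Module.support R M) :=
    ⟨fun s t => Subtype.ext (PrimeSpectrum.ext ((hsupp s s.2).trans (hsupp t t.2).symm))⟩
  exact Order.krullDim_eq_zero

end Superficial

/-! ### Maximal superficial sequences generate reductions -/

section SuperficialSequence

theorem image_lt_succ {R : Type*} {d : ℕ} (a : Fin d → R) (i : Fin d) :
    a '' {j | j.val < i.val + 1} = insert (a i) (a '' {j | j.val < i.val}) := by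
  rw [← Set.image_insert_eq]
  congr 1
  ext j
  simp only [Set.mem_ofPred_eq, Set.mem_insert_iff, Fin.ext_iff]
  omega

theorem image_lt_eq_range {R : Type*} {d : ℕ} (a : Fin d → R) :
    a '' {j | j.val < d} = Set.range a := by
  rw [← Set.image_univ]
  congr 1
  ext j
  simp

variable {R : Type*} [CommRing R] {M : Type*} [AddCommGroup M] [Module R M] {q : Ideal R}
variable [IsNoetherianRing R] [Module.Finite R M]

/-- Induct on the number of elements. The one-element case modulo the earlier elements finds w ∈ F_n
such that subtracting a_i w leaves an element of F_{n+1} in the earlier part, where the inductive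
hypothesis applies. -/
theorem IsSuperficialSequence.exists_inf_le_smul {F : q.Filtration M} (hF : IsGood F) {d : ℕ}
    {a : Fin d → R} (ha : IsSuperficialSequence F a) : ∀ i ≤ d, ∃ n₀, ∀ n ≥ n₀,
      F.N (n + 1) ⊓ Ideal.span (a '' {j | j.val < i}) • ⊤ ≤
        Ideal.span (a '' {j | j.val < i}) • F.N n := by
  intro i
  induction i with
  | zero => simp
  | succ i ih =>
    intro hi
    obtain ⟨n₀, hn₀⟩ := ih (by omega)
    have hsup := ha ⟨i, hi⟩
    obtain ⟨n₁, hn₁⟩ := hsup.exists_inf_range_le (hF.quotientFiltration _)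
    refine ⟨max n₀ n₁, fun n hn => ?_⟩
    rw [image_lt_succ a ⟨i, hi⟩, Ideal.span_insert, Submodule.sup_smul, Submodule.sup_smul,
      Submodule.ideal_span_singleton_smul, Submodule.ideal_span_singleton_smul]
    rintro x ⟨hx, hx'⟩
    obtain ⟨_, ⟨y, -, rfl⟩, z, hz, rfl⟩ := Submodule.mem_sup.1 hx'
    set Q : Submodule R M := Ideal.span (a '' {j | j.val < i}) • ⊤ with hQ
    have hmk : Q.mkQ z = 0 := (Submodule.Quotient.mk_eq_zero _).2 hz
    obtain ⟨w, ⟨w, hw, rfl⟩, hw'⟩ := hn₁ n (le_trans (le_max_right _ _) hn)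
      (⟨⟨_, hx, rfl⟩, ⟨Q.mkQ y, by
        change _ = Q.mkQ _
        rw [map_add, hmk, add_zero]
        rfl⟩⟩)
    change a ⟨i, hi⟩ • Q.mkQ w = _ at hw'
    change a ⟨i, hi⟩ • y + z ∈ F.N (n + 1) at hx
    change a ⟨i, hi⟩ • y + z ∈ _
    have hrest : a ⟨i, hi⟩ • y + z - a ⟨i, hi⟩ • w ∈ F.N (n + 1) ⊓ Q := by
      refine ⟨sub_mem hx (F.smul_le n (Submodule.smul_mem_smul hsup.1 hw)), ?_⟩
      rw [SetLike.mem_coe, ← Submodule.Quotient.mk_eq_zero, ← Submodule.mkQ_apply, map_sub,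
        map_smul, hw', sub_eq_zero]
      rfl
    rw [← add_sub_cancel (a ⟨i, hi⟩ • w) (a ⟨i, hi⟩ • y + z)]
    exact Submodule.add_mem_sup ⟨w, hw, rfl⟩ (hn₀ n (le_trans (le_max_left _ _) hn) hrest)

/-- While the dimension is positive, the next element avoids the minimal primes of the annihilator,
so it lowers the dimension by exactly one. -/
theorem IsSuperficialSequence.supportDim_add [IsLocalRing R] (hq : q.radical = maximalIdeal R)
    {F : q.Filtration M} (hF : IsGood F) {d : ℕ} (hdim : Module.supportDim R M = d)
    {a : Fin d → R} (ha : IsSuperficialSequence F a) : ∀ i ≤ d,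
      Module.supportDim R (M ⧸ (Ideal.span (a '' {j | j.val < i}) • ⊤ : Submodule R M)) + i = d := by
  intro i
  induction i with
  | zero =>
    intro _
    rw [Nat.cast_zero, add_zero, ← hdim]
    refine Module.supportDim_eq_of_equiv (Submodule.quotEquivOfEqBot _ (by simp))
  | succ i ih =>
    intro hi
    have h := ih (by omega)
    have hsup : IsSuperficial (quotientFiltration F
        (Ideal.span (a '' {j | j.val < i}) • (⊤ : Submodule R M))) (a ⟨i, hi⟩) := ha ⟨i, hi⟩
    have hne : Module.supportDim R
        (M ⧸ (Ideal.span (a '' {j | j.val < i}) • ⊤ : Submodule R M)) ≠ 0 := by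
      intro h0
      rw [h0, zero_add] at h
      have : i = d := by exact_mod_cast h
      omega
    have hmem : a ⟨i, hi⟩ ∈ maximalIdeal R := hq ▸ Ideal.le_radical hsup.1
    have := Module.supportDim_quotSMulTop_succ_eq_of_notMem_minimalPrimes_of_mem_maximalIdeal
      (hsup.notMem_of_mem_minimalPrimes hq (hF.quotientFiltration _) hne) hmem
    have heq : Module.supportDim R (QuotSMulTop (a ⟨i, hi⟩)
          (M ⧸ (Ideal.span (a '' {j | j.val < i}) • ⊤ : Submodule R M))) =
        Module.supportDim R
          (M ⧸ (Ideal.span (a '' {j | j.val < i + 1}) • ⊤ : Submodule R M)) := by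
      -- Dimension depends only on the support, so the two quotients need not be identified.
      have hs : Module.support R (QuotSMulTop (a ⟨i, hi⟩)
          (M ⧸ (Ideal.span (a '' {j | j.val < i}) • ⊤ : Submodule R M))) =
          Module.support R
            (M ⧸ (Ideal.span (a '' {j | j.val < i + 1}) • ⊤ : Submodule R M)) := by
        rw [Module.support_quotSMulTop, Module.support_quotient, Module.support_quotient,
          PrimeSpectrum.zeroLocus_span, PrimeSpectrum.zeroLocus_span, image_lt_succ a ⟨i, hi⟩,
          Set.insert_eq, PrimeSpectrum.zeroLocus_union, Set.inter_assoc, Set.inter_comm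
            (PrimeSpectrum.zeroLocus {a ⟨i, hi⟩})]
      rw [Module.supportDim, Module.supportDim, hs]
    rw [← h, ← heq, ← this]
    push_cast
    rw [add_assoc, add_comm (i : WithBot ℕ∞)]

/-- M/JM has dimension zero, so it is supported at the maximal ideal and killed by a power of q. -/
theorem IsSuperficialSequence.exists_pow_smul_top_le [IsLocalRing R]
    (hq : q.radical = maximalIdeal R)
    {F : q.Filtration M} (hF : IsGood F) {d : ℕ} (hdim : Module.supportDim R M = d)
    {a : Fin d → R} (ha : IsSuperficialSequence F a) :
    ∃ k, q ^ k • (⊤ : Submodule R M) ≤ Ideal.span (Set.range a) • ⊤ := by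
  have h := ha.supportDim_add hq hF hdim d le_rfl
  rw [image_lt_eq_range] at h
  set J := Ideal.span (Set.range a)
  have h0 : Module.supportDim R (M ⧸ (J • ⊤ : Submodule R M)) = 0 := by
    generalize Module.supportDim R (M ⧸ (J • ⊤ : Submodule R M)) = D at h
    induction D with
    | bot => simp at h
    | coe D =>
      have h' : D + d = d := by exact_mod_cast h
      have : D = 0 := WithTop.add_right_cancel (WithTop.natCast_ne_top d) (h'.trans (zero_add _).symm)
      rw [this]
      rfl
  have hsupp := support_of_supportDim_eq_zero R _ h0
  rw [Module.support_eq_zeroLocus] at hsupp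
  have hle : q ≤ (Module.annihilator R (M ⧸ (J • ⊤ : Submodule R M))).radical := by
    have := congrArg PrimeSpectrum.vanishingIdeal hsupp
    rw [PrimeSpectrum.vanishingIdeal_zeroLocus_eq_radical,
      PrimeSpectrum.vanishingIdeal_zeroLocus_eq_radical] at this
    rw [this]
    exact (Ideal.le_radical.trans hq.le).trans Ideal.le_radical
  obtain ⟨k, hk⟩ := Ideal.exists_pow_le_of_le_radical_of_fg hle (IsNoetherian.noetherian q)
  refine ⟨k, Submodule.smul_le.2 fun r hr x _ => ?_⟩
  have := Module.mem_annihilator.1 (hk hr) ((J • ⊤ : Submodule R M).mkQ x)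
  rwa [← map_smul, Submodule.mkQ_apply, Submodule.Quotient.mk_eq_zero] at this

/-- For large n, F_{n+1} ⊆ q^kM ⊆ JM, hence F_{n+1} = F_{n+1} ∩ JM ⊆ JF_n. -/
theorem IsSuperficialSequence.exists_smul_eq [IsLocalRing R]
    (hq : q.radical = maximalIdeal R)
    {F : q.Filtration M} (hF : IsGood F) {d : ℕ} (hdim : Module.supportDim R M = d)
    {a : Fin d → R} (ha : IsSuperficialSequence F a) :
    ∃ n₀, ∀ n ≥ n₀, Ideal.span (Set.range a) • F.N n = F.N (n + 1) := by
  obtain ⟨k, hk⟩ := ha.exists_pow_smul_top_le hq hF hdim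
  obtain ⟨n₀, hn₀⟩ := hF.exists_le_pow_smul_top
  obtain ⟨n₁, hn₁⟩ := ha.exists_inf_le_smul hF d le_rfl
  rw [image_lt_eq_range] at hn₁
  refine ⟨n₀ + n₁ + k, fun n hn => le_antisymm ?_ ?_⟩
  · refine (Submodule.smul_mono_left (Ideal.span_le.2 ?_)).trans (F.smul_le n)
    rintro _ ⟨i, rfl⟩
    exact (ha i).1
  · refine (le_inf le_rfl ?_).trans (hn₁ n (by omega))
    exact (F.antitone (show n₀ + k ≤ n + 1 by omega)).trans ((hn₀ k).trans hk)

end SuperficialSequence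

/-! ### Comparing the Hilbert series of two filtrations -/

section Comparison

variable {R : Type*} [CommRing R] {M : Type*} [AddCommGroup M] [Module R M]

theorem subquotientLength_eq_sum {T : ℕ → Submodule R M} {n : ℕ}
    (hT : ∀ i < n, T i ≤ T (i + 1)) :
    subquotientLength (T n) (T 0) =
      ∑ i ∈ Finset.range n, subquotientLength (T (i + 1)) (T i) := by
  suffices T 0 ≤ T n ∧ subquotientLength (T n) (T 0) =
      ∑ i ∈ Finset.range n, subquotientLength (T (i + 1)) (T i) from this.2
  induction n with
  | zero => exact ⟨le_rfl, by simp [subquotientLength_eq_zero_iff]⟩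
  | succ n ih =>
    obtain ⟨h1, h2⟩ := ih fun i hi => hT i (by omega)
    refine ⟨h1.trans (hT n (by omega)), ?_⟩
    rw [subquotientLength_add (hT n (by omega)) h1, h2, Finset.sum_range_succ, add_comm]

/-- A filtration with respect to an ideal, as a filtration with respect to a smaller ideal. -/
def restrictFiltration {q J : Ideal R} (h : J ≤ q) (F : q.Filtration M) : J.Filtration M where
  N := F.N
  mono := F.mono
  smul_le n := (Submodule.smul_mono_left h).trans (F.smul_le n)

theorem hPolynomial_spec {I : Ideal R} {F : I.Filtration M} {d : ℕ}
    (h : ∃ h : Polynomial ℤ, IsHPolynomial F d h) : IsHPolynomial F d (hPolynomial F d) := by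
  rw [hPolynomial, dif_pos h]
  exact h.choose_spec

theorem exists_pairSeries_mul_eq_of_span [IsNoetherianRing R] [Module.Finite R M] {d : ℕ}
    (a : Fin d → R) (F G : (Ideal.span (Set.range a)).Filtration M) (hF : F.Stable)
    (hGF : ∀ n, G.N n ≤ F.N n) (hfin : ∀ n, subquotientLength (F.N n) (G.N n) ≠ ⊤) :
    ∃ p : Polynomial ℤ, pairSeries F G * (1 - PowerSeries.X) ^ d = (p : PowerSeries ℤ) := by
  have hset : {x | x ∈ List.ofFn a} = Set.range a := by
    ext x
    simp [List.mem_ofFn]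
  have := exists_pairSeries_mul_eq (List.ofFn a) F G hF
    (fun x hx => Ideal.subset_span (by rwa [← hset])) hGF hfin
    ⟨⊥, by rw [hset]; exact le_sup_left, fun n => by simp⟩
  rwa [List.length_ofFn] at this

theorem hasseDeriv_two_X_sub_one_mul_eval_one (g : Polynomial ℤ) :
    (Polynomial.hasseDeriv 2 ((Polynomial.X - 1) * g)).eval 1 = g.derivative.eval 1 := by
  have h : ((Nat.factorial 2 : ℕ) • Polynomial.hasseDeriv 2 ((Polynomial.X - 1) * g)).eval 1 =
      2 * g.derivative.eval 1 := by
    have := congrFun (Polynomial.factorial_smul_hasseDeriv (R := ℤ) 2) ((Polynomial.X - 1) * g)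
    rw [LinearMap.smul_apply] at this
    rw [this]
    simp
    ring
  simp at h
  omega

/-- The difference of the second Hilbert coefficients of two filtrations, in terms of the series
of the lengths `λ(F_{n+1} / G_{n+1})`. -/
theorem hilbertCoeff_two_sub {I J : Ideal R} {F : I.Filtration M} {G : J.Filtration M}
    {d : ℕ} (hF : ∃ h, IsHPolynomial F d h) (hG : ∃ h, IsHPolynomial G d h)
    (hGF : ∀ n, G.N n ≤ F.N n) (h0 : F.N 0 = G.N 0)
    (hfin : ∀ n, subquotientLength (F.N n) (G.N (n + 1)) ≠ ⊤) {g : Polynomial ℤ}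
    (hg : (PowerSeries.mk fun n => (natLength (F.N (n + 1)) (G.N (n + 1)) : ℤ)) *
      (1 - PowerSeries.X) ^ d = (g : PowerSeries ℤ)) :
    hilbertCoeff F d 2 - hilbertCoeff G d 2 = g.derivative.eval 1 := by
  -- Split λ(F_n/G_{n+1}) once at F_{n+1} and once at G_n; in degree 0 the term λ(F_0/G_0) vanishes.
  have hdiff : hilbertSeries F - hilbertSeries G = (PowerSeries.X - 1) *
      PowerSeries.mk fun n => (natLength (F.N (n + 1)) (G.N (n + 1)) : ℤ) := by
    ext n
    have h1 := natLength_add (hfin n) (F.mono n) (hGF (n + 1))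
    have h2 := natLength_add (hfin n) (hGF n) (G.mono n)
    rw [sub_mul, one_mul]
    cases n with
    | zero =>
      rw [h0, natLength_self, zero_add] at h2
      rw [← h0] at h2
      simp [hilbertSeries, hilbertFunction]
      change (natLength _ _ : ℤ) - (natLength _ _ : ℤ) = _
      simp only [zero_add] at h1 h2
      rw [h0] at h1 ⊢
      omega
    | succ n =>
      simp only [map_sub, PowerSeries.coeff_succ_X_mul, PowerSeries.coeff_mk, hilbertSeries,
        hilbertFunction]
      change (natLength _ _ : ℤ) - (natLength _ _ : ℤ) = _
      omega
  have hpoly : hPolynomial F d - hPolynomial G d = (Polynomial.X - 1) * g := by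
    apply Polynomial.coe_injective
    rw [Polynomial.coe_sub, ← hPolynomial_spec hF, ← hPolynomial_spec hG, ← sub_mul, hdiff,
      mul_assoc, hg]
    simp
  rw [hilbertCoeff, hilbertCoeff, ← Polynomial.eval_sub, ← map_sub, hpoly,
    hasseDeriv_two_X_sub_one_mul_eval_one]

end Comparison

/-! ### Bounding g'(1) by the factors of a chain -/

section Bound

variable {R : Type*} [CommRing R] [IsNoetherianRing R] [IsLocalRing R] {M : Type*}
  [AddCommGroup M] [Module R M] [Module.Finite R M]

/-- For a filtration `F` with `J F_n = F_{n+1}` for `n ≥ n₀` and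
`∑ λ(F_{n+1} / J ^ {n+1} F_0) t ^ n = g / (1 - t) ^ d`, the derivative `g'(1)` is at most
`∑ n λ(F_{n+1} / J F_n)`. -/
theorem derivative_eval_one_le_sum {d : ℕ} (a : Fin (d + 2) → R)
    {J : Ideal R} (hJ : J = Ideal.span (Set.range a)) (F : J.Filtration M) {n₀ : ℕ}
    (hn₀ : ∀ n ≥ n₀, J • F.N n = F.N (n + 1))
    (hfin : ∀ n, subquotientLength (F.N (n + 1)) (J ^ (n + 1) • F.N 0) ≠ ⊤)
    (hfin' : ∀ n, subquotientLength (F.N (n + 1)) (J • F.N n) ≠ ⊤)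
    {g : Polynomial ℤ}
    (hg : (PowerSeries.mk fun n => (natLength (F.N (n + 1))
      (J ^ (n + 1) • F.N 0) : ℤ)) *
      (1 - PowerSeries.X) ^ (d + 2) = (g : PowerSeries ℤ)) :
    g.derivative.eval 1 ≤ ((∑ n ∈ Finset.range n₀,
      n * natLength (F.N (n + 1)) (J • F.N n) : ℕ) : ℤ) := by
  have hbounds := fun n => exists_length_pow_smul_bounds a
    (natLength (F.N (n + 1)) (J • F.N n)) (F.smul_le n) (coe_natLength (hfin' n)).symm
  simp only [← hJ] at hbounds
  choose r hr c e hre using hbounds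
  -- The chain J^{m+1-n}F_n can stop at n = n₀, since J^{m+1-n₀}F_{n₀} is already F_{m+1}.
  have hsum : ∀ m ≥ n₀, subquotientLength (F.N (m + 1)) (J ^ (m + 1) • F.N 0) =
      ∑ n ∈ Finset.range n₀,
        subquotientLength (J ^ (m - n) • F.N (n + 1)) (J ^ (m - n) • (J • F.N n)) := by
    intro m hm
    have hstep : ∀ n, n < n₀ → J ^ (m + 1 - n) • F.N n = J ^ (m - n) • (J • F.N n) := by
      intro n hn
      rw [show m + 1 - n = m - n + 1 by omega, pow_succ, Submodule.mul_smul]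
    have := subquotientLength_eq_sum (T := fun n => J ^ (m + 1 - n) • F.N n) (n := n₀) (by
      intro n hn
      rw [hstep n hn, show m + 1 - (n + 1) = m - n by omega]
      exact smul_mono_right _ (F.smul_le n))
    have hlast : ∀ k, J ^ k • F.N n₀ = F.N (n₀ + k) := by
      intro k
      induction k with
      | zero => simp
      | succ k ih => rw [pow_succ', Submodule.mul_smul, ih, hn₀ _ (by omega)]; rfl
    rw [hlast, show n₀ + (m + 1 - n₀) = m + 1 by omega] at this
    rw [show m + 1 - 0 = m + 1 by omega] at this
    rw [this]
    refine Finset.sum_congr rfl fun n hn => ?_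
    rw [hstep n (Finset.mem_range.1 hn), show m + 1 - (n + 1) = m - n by omega]
  -- The threshold ensures e n ≤ m - n for every n < n₀, so all the bounds hold at once.
  have hbd : ∀ m ≥ n₀ + ∑ n ∈ Finset.range n₀, e n,
      (∑ n ∈ Finset.range n₀, r n * (m - n + d + 1).choose (d + 1)) ≤
        natLength (F.N (m + 1)) (J ^ (m + 1) • F.N 0) ∧
      natLength (F.N (m + 1)) (J ^ (m + 1) • F.N 0) ≤
        (∑ n ∈ Finset.range n₀, r n * (m - n + d + 1).choose (d + 1)) +
          (∑ n ∈ Finset.range n₀, c n) * (d + m).choose d := by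
    intro m hm
    have hcast := (coe_natLength (hfin m)).trans (hsum m (by omega))
    have hem : ∀ n ∈ Finset.range n₀, e n ≤ m - n := fun n hn => by
      have h1 := Finset.single_le_sum (f := e) (fun i _ => Nat.zero_le _) hn
      have h2 := Finset.mem_range.1 hn
      omega
    constructor
    · have : ((∑ n ∈ Finset.range n₀, r n * (m - n + d + 1).choose (d + 1) : ℕ) : ℕ∞) ≤
          natLength (F.N (m + 1)) (J ^ (m + 1) • F.N 0) := by
        rw [hcast, Nat.cast_sum]
        exact Finset.sum_le_sum fun n hn => (hre n _ (hem n hn)).1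
      exact_mod_cast this
    · have : (natLength (F.N (m + 1)) (J ^ (m + 1) • F.N 0) : ℕ∞) ≤
          (∑ n ∈ Finset.range n₀, (r n * (m - n + d + 1).choose (d + 1) +
            c n * (m - n + d).choose d) : ℕ) := by
        rw [hcast, Nat.cast_sum]
        exact Finset.sum_le_sum fun n hn => (hre n _ (hem n hn)).2
      refine (Nat.cast_le.1 this).trans ?_
      rw [Finset.sum_add_distrib, Finset.sum_mul]
      exact Nat.add_le_add_left (Finset.sum_le_sum fun n _ =>
        Nat.mul_le_mul le_rfl (Nat.choose_le_choose _ (by omega))) _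
  set B : PowerSeries ℤ := PowerSeries.mk fun n => ((d + 1 + n).choose (d + 1) : ℤ) with hB
  have hBm : B * (1 - PowerSeries.X) ^ (d + 2) = 1 :=
    PowerSeries.mk_add_choose_mul_one_sub_pow_eq_one ℤ (d + 1)
  -- From degree n₀ on, D·B has the leading terms of the lengths as its coefficients; subtracting it
  -- leaves only the lower-order error.
  set D : Polynomial ℤ := ∑ n ∈ Finset.range n₀, Polynomial.C (r n : ℤ) * Polynomial.X ^ n with hD
  have hcoeff : ∀ m ≥ n₀, PowerSeries.coeff m ((D : PowerSeries ℤ) * B) =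
      ((∑ n ∈ Finset.range n₀, r n * (m - n + d + 1).choose (d + 1) : ℕ) : ℤ) := by
    intro m hm
    have hcoe : (D : PowerSeries ℤ) = ∑ n ∈ Finset.range n₀,
        PowerSeries.C (r n : ℤ) * PowerSeries.X ^ n := by
      rw [hD, ← Polynomial.coeToPowerSeries.ringHom_apply, map_sum]
      refine Finset.sum_congr rfl fun n _ => ?_
      rw [Polynomial.coeToPowerSeries.ringHom_apply, Polynomial.coe_mul, Polynomial.coe_pow,
        Polynomial.coe_C, Polynomial.coe_X]
    rw [hcoe, Finset.sum_mul, map_sum, Nat.cast_sum]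
    refine Finset.sum_congr rfl fun n hn => ?_
    have hnm : n ≤ m := (Finset.mem_range.1 hn).le.trans hm
    rw [mul_assoc, PowerSeries.coeff_C_mul, PowerSeries.coeff_X_pow_mul', if_pos hnm, hB,
      PowerSeries.coeff_mk, show d + 1 + (m - n) = m - n + d + 1 by omega, Nat.cast_mul]
  have hmain := derivative_eval_one_nonpos (d := d) (c := ∑ n ∈ Finset.range n₀, c n)
    (S := (PowerSeries.mk fun n => (natLength (F.N (n + 1)) (J ^ (n + 1) • F.N 0) : ℤ)) -
      (D : PowerSeries ℤ) * B) (p := g - D)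
    (by rw [sub_mul, hg, mul_assoc, hBm, mul_one, Polynomial.coe_sub])
    ⟨n₀ + ∑ n ∈ Finset.range n₀, e n, fun m hm => by
      obtain ⟨h1, h2⟩ := hbd m hm
      rw [map_sub, hcoeff m (by omega), PowerSeries.coeff_mk]
      zify at h1 h2
      push_cast at h1 h2 ⊢
      constructor <;> linarith⟩
  have hDd : D.derivative.eval 1 = ∑ n ∈ Finset.range n₀, (n : ℤ) * r n := by
    simp [hD, Polynomial.eval_finsetSum, Polynomial.derivative_X_pow, mul_comm]
  rw [Polynomial.derivative_sub, Polynomial.eval_sub, hDd] at hmain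
  have hle : ∑ n ∈ Finset.range n₀, (n : ℤ) * r n ≤ ((∑ n ∈ Finset.range n₀,
      n * natLength (F.N (n + 1)) (J • F.N n) : ℕ) : ℤ) := by
    push_cast
    gcongr with n hn
    exact hr n
  linarith

end Bound

end HilbertFiltration

/-! ### The inequality for the second coefficients -/

open HilbertFiltration in
/-- The term `n = 0` of the sum is zero; the sum converges to a natural number `s`. -/
theorem theorem2 {R : Type*} [CommRing R] [IsNoetherianRing R] [IsLocalRing R]
    [Infinite (IsLocalRing.ResidueField R)]
    {M : Type*} [AddCommGroup M] [Module R M] [Module.Finite R M]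
    (d : ℕ) (hd : 2 ≤ d) (hdim : Module.supportDim R M = d)
    (q : Ideal R) (hq : q.radical = IsLocalRing.maximalIdeal R)
    (F : q.Filtration M) (hF : HilbertFiltration.IsGood F)
    (a : Fin d → R) (ha : HilbertFiltration.IsSuperficialSequence F a)
    (J : Ideal R) (hJ : J = Ideal.span (Set.range a))
    (hdepth : ((d - 1 : ℕ) : ℕ∞) ≤
      HilbertFiltration.grDepth (HilbertFiltration.adicFiltration J M)) :
    ∃ s : ℕ,
      HasSum (fun n : ℕ =>
        (n : ℕ∞) * HilbertFiltration.subquotientLength (F.N (n + 1)) (J • F.N n)) (s : ℕ∞) ∧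
      HilbertFiltration.hilbertCoeff F d 2 -
        HilbertFiltration.hilbertCoeff (HilbertFiltration.adicFiltration J M) d 2 ≤ (s : ℤ) := by
  -- From here on, d stands for dim M - 2.
  obtain ⟨d, rfl⟩ : ∃ e, d = e + 2 := ⟨d - 2, by omega⟩
  subst hJ
  set J := Ideal.span (Set.range a)
  have hJq : J ≤ q := Ideal.span_le.2 (by rintro _ ⟨i, rfl⟩; exact (ha i).1)
  obtain ⟨n₀, hn₀⟩ := ha.exists_smul_eq hq hF hdim
  obtain ⟨k, hk⟩ := ha.exists_pow_smul_top_le hq hF hdim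
  have hadic : ∀ n, (adicFiltration J M).N n = J ^ n • ⊤ := fun n => rfl
  have hkn : ∀ n, q ^ (k * n) • (⊤ : Submodule R M) ≤ J ^ n • ⊤ := by
    intro n
    induction n with
    | zero => simp
    | succ n ih =>
      rw [mul_add, mul_one, pow_add, Submodule.mul_smul, pow_succ, Submodule.mul_smul]
      refine (smul_mono_right _ hk).trans ?_
      rw [← Submodule.mul_smul, mul_comm, Submodule.mul_smul]
      refine (smul_mono_right _ ih).trans ?_
      rw [← Submodule.mul_smul, ← Submodule.mul_smul, mul_comm]
  -- Since q^{kn}M ⊆ J^nM, every subquotient above some J^nM has finite length.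
  have hfinite : ∀ {A B : Submodule R M} {n : ℕ}, J ^ n • ⊤ ≤ B → B ≤ A →
      subquotientLength A B ≠ ⊤ := fun {_ _ n} hB hBA =>
    subquotientLength_ne_top_of_le (subquotientLength_top_pow_smul_ne_top hq (k * n))
      ((hkn n).trans hB) hBA
  have hNF : ∀ n, (adicFiltration J M).N n ≤ F.N n := fun n =>
    (Submodule.smul_mono_left (Ideal.pow_right_mono hJq n)).trans (hF.pow_smul_top_le n)
  let F' := restrictFiltration hJq F
  have hF' : F'.Stable := ⟨n₀, hn₀⟩
  have hN : (adicFiltration J M).Stable := J.stableFiltration_stable ⊤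
  have hfinJ : ∀ n, subquotientLength (F.N (n + 1)) (J • F.N n) ≠ ⊤ := fun n =>
    hfinite (n := n + 1) (by
      rw [pow_succ', Submodule.mul_smul]
      exact smul_mono_right _ (hNF n)) (F'.smul_le n)
  obtain ⟨g, hg⟩ := exists_pairSeries_mul_eq_of_span a (shiftFiltration F')
    (shiftFiltration (adicFiltration J M)) (shiftFiltration_stable hF') (fun n => hNF (n + 1))
    (fun n => hfinite le_rfl (hNF (n + 1)))
  refine ⟨∑ n ∈ Finset.range n₀, n * natLength (F.N (n + 1)) (J • F.N n), ?_, ?_⟩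
  · have hcast : ((∑ n ∈ Finset.range n₀, n * natLength (F.N (n + 1)) (J • F.N n) : ℕ) : ℕ∞) =
        ∑ n ∈ Finset.range n₀, (n : ℕ∞) * subquotientLength (F.N (n + 1)) (J • F.N n) := by
      rw [Nat.cast_sum]
      exact Finset.sum_congr rfl fun n _ => by rw [Nat.cast_mul, coe_natLength (hfinJ n)]
    rw [hcast]
    refine hasSum_sum_of_ne_finset_zero fun n hn => ?_
    rw [subquotientLength_eq_zero_iff.2 (hn₀ n (by simpa using hn)).ge, mul_zero]
  -- The two Hilbert series unfold to `pairSeries` of a filtration and its shift, so Hilbert-Serre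
  -- supplies both h-polynomials.
  · rw [hilbertCoeff_two_sub (F := F) (G := adicFiltration J M) (g := g)
      (exists_pairSeries_mul_eq_of_span a F' (shiftFiltration F') hF' F.mono
        fun n => hfinite (hNF (n + 1)) (F.mono n))
      (exists_pairSeries_mul_eq_of_span a (adicFiltration J M)
        (shiftFiltration (adicFiltration J M)) hN (adicFiltration J M).mono
        fun n => hfinite le_rfl ((adicFiltration J M).mono n))
      hNF (by rw [hF.zero_eq_top, hadic, pow_zero, one_smul])
      (fun n => hfinite le_rfl (((adicFiltration J M).mono n).trans (hNF n))) hg]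
    have h0 : F'.N 0 = ⊤ := hF.zero_eq_top
    refine derivative_eval_one_le_sum a rfl F' hn₀ (fun n => ?_) hfinJ ?_
    · rw [h0]
      exact hfinite le_rfl (hNF (n + 1))
    · rw [h0]
      exact hg
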